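/- Let $p$ be a prime, let $m \ge 2$ be an integer, and let $\delta, \nu, \epsilon > 0$ be real numbers. View $\{0,1\}^n$ as a subset of $\mathbb{F}_p^n$, and call a linear form $\phi : \mathbb{F}_p^n \to \mathbb{F}_p$ a mod-$p$ form. For non-empty subsets $\mathcal{B}_1, \dots, \mathcal{B}_m$ of $\{0,1\}^n$ and a mod-$p$ form $\phi$, define the correlation \[ \mathrm{cor}_{\mathcal{B}_1, \dots, \mathcal{B}_m} \phi = \Big( \sum_{y \in \mathbb{F}_p} \prod_{t=1}^m \mathbb{P}_{x \in \mathcal{B}_t}[\phi(x) = y] \Big) - \frac{1}{p^{m-1}}, \] where $\mathbb{P}_{x \in \mathcal{B}}$ denotes the probability when $x$ is chosen uniformly at random in $\mathcal{B}$. Then there exists a real number $C = C(\delta, \nu, \epsilon, p, m) > 0$ such that the following holds for all non-negative integers $n$ and all positive integers $s$. If $\mathcal{A}_1, \dots, \mathcal{A}_s$ are (not necessarily distinct) non-empty subsets of $\{0,1\}^n$, each with density $|\mathcal{A}_i|/2^n$ at least $\delta$, then there exists a subset $R$ of $[s] = \{1, \dots, s\}$ with $|R| \ge s/(n+1)^{C}$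 such that for at least $(1-\epsilon)|R|^m$ of the $m$-tuples $(i_1, \dots, i_m) \in R^m$ we have \[ \mathrm{cor}_{\mathcal{A}_{i_1}, \dots, \mathcal{A}_{i_m}} \phi \ge -\nu \] for every mod-$p$ form $\phi : \mathbb{F}_p^n \to \mathbb{F}_p$. -/

import Mathlib

/-- The discrete cube `{0,1}^n`. -/
abbrev Cube (n : ℕ) : Type := Fin n → Fin 2

/-- The inclusion of `{0,1}^n` into `𝔽_p^n`. -/
def Cube.toZMod (p : ℕ) {n : ℕ} (x : Cube n) : Fin n → ZMod p :=
  fun z => ((x z : ℕ) : ZMod p)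

/-- A mod-`p` linear form in `n` variables. -/
abbrev ModForm (p n : ℕ) : Type := (Fin n → ZMod p) →ₗ[ZMod p] ZMod p

/-- The distribution of `F x` for `x` uniform in the (non-empty) finite set `A`, given by its
point masses: `d ↦ ℙ_{x ∈ A}[F x = d]`. -/
noncomputable def distOn {α D : Type*} [DecidableEq D] (A : Finset α) (F : α → D) (d : D) : ℝ :=
  ((A.filter fun x => F x = d).card : ℝ) / (A.card : ℝ)

/-- The correlation of an `m`-tuple (`m ≥ 1`) of distributions on a finite set `D`, each given by
its point masses: `(∑_d ℙ[X₁ = d] ⋯ ℙ[X_m = d]) - 1 / |D|^(m-1)`. -/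
noncomputable def correlation {D : Type*} [Fintype D] {m : ℕ} (X : Fin m → D → ℝ) : ℝ :=
  (∑ d : D, ∏ t : Fin m, X t d) - 1 / (Fintype.card D : ℝ) ^ (m - 1)

/-- The correlation of the distributions of the restriction to the cube of the mod-`p` form `φ` on
each of the subsets `A 0, …, A (m-1)` of the cube. -/
noncomputable def formCorrelation {p n m : ℕ} [NeZero p] (A : Fin m → Finset (Cube n))
    (φ : ModForm p n) : ℝ :=
  correlation fun t => distOn (A t) fun x => φ (x.toZMod p)

/-!
Call a form biased on a dense set `A` if it takes some value on `A` with probability below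
`1 / p - η`. By Fourier inversion some character then has a large sum over `A`. The character sums
over the whole cube of forms far apart in the Hamming distance are nearly orthogonal, so Halász's
inequality leaves only polynomially many biased forms. By Hoeffding's inequality and a union bound,
a random sample of `O(log n)` points of `A` therefore represents, with probability at least `1 / 2`
and up to `η`, all these forms at once. Since `A` has density at least `δ`, at least a proportion
`δ ^ k / 2` of all samples of `k` points of the cube represents it; for `k = O(log n)` this is only
polynomially small in `n`, so by double counting one sample serves a polynomially small proportion
of the sets. On each of these sets, the distribution of every form dominates, up to `η`, either its
distribution on the common sample or the uniform one. By convexity, the product of copies of one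
distribution and of the uniform one has a total at least that of the product of uniform ones, hence
no correlation is very negative.
-/

open Finset

section Correlation

variable {D : Type*} [Fintype D]

/-- The point masses of the uniform distribution on `D`. -/
noncomputable def uniformMass (D : Type*) [Fintype D] : D → ℝ :=
  fun _ => 1 / Fintype.card D

/-- The point masses `X` are at least the point masses `E`, up to an additive error `η`. This
one-sided comparison is all that a lower bound for a correlation needs. -/
def DominatesUpTo {D : Type*} (η : ℝ) (X E : D → ℝ) : Prop :=
  ∀ d, E d - η ≤ X d

theorem uniformMass_mem_stdSimplex [Nonempty D] : uniformMass D ∈ stdSimplex ℝ D :=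
  ⟨fun _ => by unfold uniformMass; positivity, by simp [uniformMass]⟩

theorem distOn_mem_stdSimplex {α : Type*} [DecidableEq D] {A : Finset α} (hA : A.Nonempty)
    (F : α → D) : distOn A F ∈ stdSimplex ℝ D := by
  refine ⟨fun d => by unfold distOn; positivity, ?_⟩
  have hfibers := card_eq_sum_card_fiberwise (f := F) (s := A) (t := univ) fun _ _ => by simp
  simp only [distOn]
  rw [← sum_div, ← Nat.cast_sum, ← hfibers, div_self (by exact_mod_cast hA.card_ne_zero)]

theorem prod_sub_card_mul_le_prod {ι : Type*} (s : Finset ι) {X Y : ι → ℝ} {η : ℝ} (hη : 0 ≤ η)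
    (hX : ∀ t ∈ s, X t ∈ Set.Icc 0 1) (hY : ∀ t ∈ s, Y t ∈ Set.Icc 0 1)
    (h : ∀ t ∈ s, Y t - η ≤ X t) : ∏ t ∈ s, Y t - #s * η ≤ ∏ t ∈ s, X t := by
  induction s using Finset.cons_induction with
  | empty => simp
  | cons a s ha ih =>
    rw [forall_mem_cons] at hX hY h
    have hprod0 : 0 ≤ ∏ t ∈ s, Y t := prod_nonneg fun t ht => (hY.2 t ht).1
    have hprod1 : ∏ t ∈ s, Y t ≤ 1 :=
      prod_le_one (fun t ht => (hY.2 t ht).1) fun t ht => (hY.2 t ht).2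
    rw [prod_cons, prod_cons, card_cons]
    have hX_le : X a * (#s * η) ≤ #s * η := mul_le_of_le_one_left (by positivity) hX.1.2
    have hη_le : η * ∏ t ∈ s, Y t ≤ η := mul_le_of_le_one_right hη hprod1
    calc Y a * ∏ t ∈ s, Y t - (#s + 1 : ℕ) * η
        = Y a * ∏ t ∈ s, Y t - η - #s * η := by push_cast; ring
      _ ≤ Y a * ∏ t ∈ s, Y t - η * ∏ t ∈ s, Y t - X a * (#s * η) := by gcongr
      _ = (Y a - η) * ∏ t ∈ s, Y t - X a * (#s * η) := by ring
      _ ≤ X a * ∏ t ∈ s, Y t - X a * (#s * η) := by gcongr; exact h.1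
      _ = X a * (∏ t ∈ s, Y t - #s * η) := by ring
      _ ≤ X a * ∏ t ∈ s, X t := mul_le_mul_of_nonneg_left (ih hX.2 hY.2 h.2) hX.1.1

theorem sum_uniformMass_pow_le_sum_pow [Nonempty D] {E : D → ℝ} (hE : E ∈ stdSimplex ℝ D) (v : ℕ) :
    ∑ d, uniformMass D d ^ v ≤ ∑ d, E d ^ v := by
  have hmean := Real.pow_arith_mean_le_arith_mean_pow univ (uniformMass D) E
    (fun d _ => uniformMass_mem_stdSimplex.1 d) uniformMass_mem_stdSimplex.2 (fun d _ => hE.1 d) v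
  simp only [uniformMass, ← mul_sum, hE.2, mul_one] at hmean ⊢
  have hD : (0 : ℝ) < Fintype.card D := by exact_mod_cast Fintype.card_pos
  rw [one_div_mul_eq_div, le_div_iff₀' hD] at hmean
  simpa using hmean

theorem sum_prod_uniformMass [Nonempty D] {m : ℕ} (hm : 0 < m) :
    ∑ d, ∏ _t : Fin m, uniformMass D d = 1 / (Fintype.card D : ℝ) ^ (m - 1) := by
  obtain ⟨m, rfl⟩ := Nat.exists_eq_add_one.mpr hm
  simp [uniformMass, pow_succ]

theorem sum_prod_uniformMass_le_sum_prod [Nonempty D] {ι : Type*} [Fintype ι] {E : D → ℝ}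
    (hE : E ∈ stdSimplex ℝ D) {Y : ι → D → ℝ} (hY : ∀ t, Y t = E ∨ Y t = uniformMass D) :
    ∑ d, ∏ _t : ι, uniformMass D d ≤ ∑ d, ∏ t, Y t d := by
  classical
  set v := #{t | Y t = E}
  set r := #{t | ¬ Y t = E}
  have hcard : Fintype.card ι = v + r := (card_filter_add_card_filter_not _).symm
  have hprod (d : D) : ∏ t, Y t d = E d ^ v * uniformMass D d ^ r := by
    rw [← prod_filter_mul_prod_filter_not univ (fun t => Y t = E)]
    congr 1
    · exact prod_eq_pow_card fun t ht => by rw [(mem_filter.mp ht).2]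
    · exact prod_eq_pow_card fun t ht => by rw [(hY t).resolve_left (mem_filter.mp ht).2]
  calc ∑ d, ∏ _t : ι, uniformMass D d = (∑ d, uniformMass D d ^ v) * (1 / Fintype.card D) ^ r := by
        simp only [prod_const, card_univ, hcard, pow_add, ← sum_mul, uniformMass]
    _ ≤ (∑ d, E d ^ v) * (1 / Fintype.card D) ^ r := by
        exact mul_le_mul_of_nonneg_right (sum_uniformMass_pow_le_sum_pow hE v) (by positivity)
    _ = ∑ d, ∏ t, Y t d := by simp only [hprod, ← sum_mul, uniformMass]

theorem neg_le_correlation [Nonempty D] {m : ℕ} (hm : 0 < m) {X : Fin m → D → ℝ}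
    (hX : ∀ t, X t ∈ stdSimplex ℝ D) {E : D → ℝ} (hE : E ∈ stdSimplex ℝ D) {η : ℝ} (hη : 0 ≤ η)
    (h : ∀ t, DominatesUpTo η (X t) E ∨ DominatesUpTo η (X t) (uniformMass D)) :
    -(Fintype.card D * (m * η)) ≤ correlation X := by
  have hchoice (t : Fin m) : ∃ Y ∈ stdSimplex ℝ D, (Y = E ∨ Y = uniformMass D) ∧
      DominatesUpTo η (X t) Y :=
    (h t).elim (fun ht => ⟨E, hE, .inl rfl, ht⟩)
      fun ht => ⟨uniformMass D, uniformMass_mem_stdSimplex, .inr rfl, ht⟩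
  choose Y hY hYE hXY using hchoice
  have hpointwise (d : D) : ∏ t, Y t d - m * η ≤ ∏ t, X t d := by
    simpa using prod_sub_card_mul_le_prod univ hη (fun t _ => mem_Icc_of_mem_stdSimplex (hX t) d)
      (fun t _ => mem_Icc_of_mem_stdSimplex (hY t) d) fun t _ => hXY t d
  have hsum := sum_le_sum fun d (_ : d ∈ univ) => hpointwise d
  rw [sum_sub_distrib, sum_const, card_univ, nsmul_eq_mul] at hsum
  have huniform := sum_prod_uniformMass_le_sum_prod hE hYE
  rw [sum_prod_uniformMass hm] at huniform
  unfold correlation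
  linarith

end Correlation

section Sampling

open MeasureTheory ProbabilityTheory

variable {α β D κ : Type*} [DecidableEq D] [Fintype κ]

theorem integral_uniformOn_finset [MeasurableSpace α] [MeasurableSingletonClass α] (A : Finset α)
    (f : α → ℝ) : ∫ a, f a ∂uniformOn (A : Set α) = (∑ a ∈ A, f a) / #A := by
  have hf : IntegrableOn f A Measure.count := by
    rw [← (A : Set α).biUnion_of_singleton]
    simp [integrableOn_finset_iUnion]
  rw [uniformOn, ProbabilityTheory.cond, integral_smul_measure, setIntegral_finset _ hf]
  simp [div_eq_inv_mul, measureReal_def]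

theorem measureReal_pi_uniformOn_finset [Finite α] [MeasurableSpace α] [MeasurableSingletonClass α]
    [DecidableEq κ] (A : Finset α) (P : (κ → α) → Prop) [DecidablePred P] :
    (Measure.pi fun _ : κ => uniformOn (A : Set α)).real {x | P x} =
      #{x ∈ Fintype.piFinset fun _ : κ => A | P x} / (#A : ℝ) ^ Fintype.card κ := by
  classical
  have := Fintype.ofFinite α
  have hP : {x | P x} = ((univ.filter P : Finset (κ → α)) : Set (κ → α)) := by simp
  rw [← uniformOn_pi, ← Fintype.coe_piFinset, measureReal_def, hP, uniformOn_apply_finset,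
    inter_filter, inter_univ]
  simp

open scoped Classical in
theorem card_filter_distOn_add_le_distOn_comp_le [Finite α] {A : Finset α} (hA : A.Nonempty)
    (F : α → D) (d : D) {η : ℝ} (hη : 0 ≤ η) :
    (#{x ∈ Fintype.piFinset fun _ : κ => A | distOn A F d + η ≤ distOn univ (F ∘ x) d} : ℝ)
      ≤ (#A : ℝ) ^ Fintype.card κ * Real.exp (-(2 * Fintype.card κ * η ^ 2)) := by
  let _ : MeasurableSpace α := ⊤
  have : MeasurableSingletonClass α := ⟨fun _ => trivial⟩
  have : IsProbabilityMeasure (uniformOn (A : Set α)) :=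
    isProbabilityMeasure_uniformOn A.finite_toSet hA
  let μ : Measure (κ → α) := Measure.pi fun _ => uniformOn (A : Set α)
  let f : α → ℝ := fun a => if F a = d then 1 else 0
  have hmean (j : κ) : ∫ x : κ → α, f (x j) ∂μ = distOn A F d := by
    rw [integral_comp_eval (measurable_of_countable f).aestronglyMeasurable,
      integral_uniformOn_finset]
    simp [f, distOn]
  have hindep : iIndepFun (fun j (x : κ → α) => f (x j) - distOn A F d) μ :=
    iIndepFun_pi (X := fun _ a => f a - distOn A F d)
      fun _ => (measurable_of_countable _).aemeasurable
  have hsubG (j : κ) : HasSubgaussianMGF (fun x : κ → α => f (x j) - distOn A F d)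
      ((‖(1 : ℝ) - 0‖₊ / 2) ^ 2) μ := by
    rw [← hmean j]
    refine hasSubgaussianMGF_of_mem_Icc (measurable_of_countable _).aemeasurable
      (ae_of_all _ fun x => ?_)
    dsimp only [f]; split_ifs <;> simp
  have hoeffding := HasSubgaussianMGF.measure_sum_ge_le_of_iIndepFun hindep (s := univ)
    (fun j _ => hsubG j) (ε := Fintype.card κ * η) (by positivity)
  have hsubset : {x : κ → α | distOn A F d + η ≤ distOn univ (F ∘ x) d} ⊆
      {x | Fintype.card κ * η ≤ ∑ j, (f (x j) - distOn A F d)} := fun x hx => by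
    have hcount : (distOn A F d + η) * Fintype.card κ ≤ #{j | F (x j) = d} :=
      mul_le_of_le_div₀ (Nat.cast_nonneg _) (Nat.cast_nonneg _) hx
    simp only [f, Set.mem_ofPred_eq, sum_sub_distrib, sum_boole, sum_const, card_univ, nsmul_eq_mul]
    linarith
  have hbound := (measureReal_mono hsubset).trans hoeffding
  rw [measureReal_pi_uniformOn_finset, div_le_iff₀' (by have := hA.card_pos; positivity)] at hbound
  have hexponent : -(Fintype.card κ * η) ^ 2 /
      (2 * (∑ _j : κ, (‖(1 : ℝ) - 0‖₊ / 2) ^ 2 : NNReal)) = -(2 * Fintype.card κ * η ^ 2) := by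
    rcases isEmpty_or_nonempty κ <;> simp
    field_simp
  rwa [hexponent] at hbound

open scoped Classical in
theorem half_card_pow_le_card_filter_dominatesUpTo [Finite α] [Fintype D] {A : Finset α}
    (hA : A.Nonempty) (𝓕 : Finset β) (F : β → α → D) {η : ℝ} (hη : 0 ≤ η)
    (hκ : #𝓕 * Fintype.card D * Real.exp (-(2 * Fintype.card κ * η ^ 2)) ≤ 1 / 2) :
    (#A : ℝ) ^ Fintype.card κ / 2 ≤ #{x ∈ Fintype.piFinset fun _ : κ => A |
      ∀ b ∈ 𝓕, DominatesUpTo η (distOn A (F b)) (distOn univ (F b ∘ x))} := by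
  set S := Fintype.piFinset fun _ : κ => A
  set good : (κ → α) → Prop := fun x =>
    ∀ b ∈ 𝓕, DominatesUpTo η (distOn A (F b)) (distOn univ (F b ∘ x)) with hgood
  let bad (bd : β × D) : Finset (κ → α) :=
    {x ∈ S | distOn A (F bd.1) bd.2 + η ≤ distOn univ (F bd.1 ∘ x) bd.2}
  have hcover : {x ∈ S | ¬ good x} ⊆ (𝓕 ×ˢ univ).biUnion bad := fun x hx => by
    obtain ⟨hxS, hx⟩ := mem_filter.mp hx
    simp only [hgood, DominatesUpTo, not_forall, not_le] at hx
    obtain ⟨b, hb, d, hd⟩ := hx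
    exact mem_biUnion.mpr ⟨(b, d), mem_product.mpr ⟨hb, mem_univ d⟩,
      mem_filter.mpr ⟨hxS, (lt_sub_iff_add_lt.mp hd).le⟩⟩
  have hbad : (#{x ∈ S | ¬ good x} : ℝ) ≤ (#A : ℝ) ^ Fintype.card κ / 2 :=
    calc (#{x ∈ S | ¬ good x} : ℝ) ≤ ∑ bd ∈ 𝓕 ×ˢ univ, (#(bad bd) : ℝ) := by
          exact_mod_cast (card_le_card hcover).trans card_biUnion_le
      _ ≤ #(𝓕 ×ˢ (univ : Finset D)) • ((#A : ℝ) ^ Fintype.card κ *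
            Real.exp (-(2 * Fintype.card κ * η ^ 2))) :=
          sum_le_card_nsmul _ _ _ fun bd _ =>
            card_filter_distOn_add_le_distOn_comp_le hA (F bd.1) bd.2 hη
      _ = (#A : ℝ) ^ Fintype.card κ *
            (#𝓕 * Fintype.card D * Real.exp (-(2 * Fintype.card κ * η ^ 2))) := by
          rw [nsmul_eq_mul, card_product, card_univ]; push_cast; ring
      _ ≤ (#A : ℝ) ^ Fintype.card κ * (1 / 2) := by gcongr
      _ = (#A : ℝ) ^ Fintype.card κ / 2 := by ring
  have htotal : (#{x ∈ S | good x} : ℝ) + #{x ∈ S | ¬ good x} = (#A : ℝ) ^ Fintype.card κ := by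
    have hS : #S = #A ^ Fintype.card κ := by simp [S]
    exact_mod_cast (card_filter_add_card_filter_not good).trans hS
  linarith

theorem mul_card_le_card_of_le_dens [Fintype α] {A : Finset α} {δ : ℝ} (hA : δ ≤ A.dens) :
    δ * Fintype.card α ≤ #A := by
  rw [← A.nnratCast_dens_mul_natCast_card]
  gcongr

theorem exists_common_sample [Fintype α] [Nonempty α] [Fintype D] {ι : Type*} [Fintype ι]
    (A : ι → Finset α) {δ : ℝ} (hδ : 0 < δ) (hA : ∀ i, δ ≤ (A i).dens) (𝓕 : ι → Finset β)
    (F : β → α → D) {η : ℝ} (hη : 0 ≤ η)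
    (hκ : ∀ i, #(𝓕 i) * Fintype.card D * Real.exp (-(2 * Fintype.card κ * η ^ 2)) ≤ 1 / 2) :
    ∃ (x : κ → α) (R : Finset ι), Fintype.card ι * (δ ^ Fintype.card κ / 2) ≤ #R ∧
      ∀ i ∈ R, ∀ b ∈ 𝓕 i, DominatesUpTo η (distOn (A i) (F b)) (distOn univ (F b ∘ x)) := by
  classical
  let fits (x : κ → α) (i : ι) : Prop :=
    ∀ b ∈ 𝓕 i, DominatesUpTo η (distOn (A i) (F b)) (distOn univ (F b ∘ x))
  let M : ℝ := (Fintype.card α : ℝ) ^ Fintype.card κ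
  have hfits (i : ι) : M * (δ ^ Fintype.card κ / 2) ≤ #{x | fits x i} := by
    have hdens := mul_card_le_card_of_le_dens (hA i)
    have hAi : (A i).Nonempty := dens_pos.mp (by exact_mod_cast hδ.trans_le (hA i))
    calc M * (δ ^ Fintype.card κ / 2) = (δ * Fintype.card α) ^ Fintype.card κ / 2 := by ring
      _ ≤ (#(A i) : ℝ) ^ Fintype.card κ / 2 := by gcongr
      _ ≤ #{x ∈ Fintype.piFinset fun _ : κ => A i | fits x i} :=
          half_card_pow_le_card_filter_dominatesUpTo hAi (𝓕 i) F hη (hκ i)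
      _ ≤ #{x | fits x i} := by gcongr; exact subset_univ _
  have hcount : ∑ x, (#{i | fits x i} : ℝ) = ∑ i, (#{x | fits x i} : ℝ) := by
    exact_mod_cast sum_card_bipartiteAbove_eq_sum_card_bipartiteBelow fits
  obtain ⟨x, -, hx⟩ : ∃ x ∈ (univ : Finset (κ → α)),
      Fintype.card ι * (δ ^ Fintype.card κ / 2) ≤ (#{i | fits x i} : ℝ) := by
    refine exists_le_of_sum_le univ_nonempty ?_
    calc ∑ _x : κ → α, (Fintype.card ι * (δ ^ Fintype.card κ / 2) : ℝ)
        = Fintype.card ι • (M * (δ ^ Fintype.card κ / 2)) := by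
          simp [M]; ring
      _ ≤ ∑ i, (#{x | fits x i} : ℝ) := card_nsmul_le_sum univ _ _ fun i _ => hfits i
      _ = ∑ x, (#{i | fits x i} : ℝ) := hcount.symm
  exact ⟨x, _, hx, fun i hi => (mem_filter.mp hi).2⟩

end Sampling

section Fourier

theorem dominatesUpTo_uniformMass_of_norm_sum_le {G α : Type*} [AddCommGroup G] [Fintype G]
    [DecidableEq G] {A : Finset α} (hA : A.Nonempty) (F : α → G) {η : ℝ} (hη : 0 ≤ η)
    (h : ∀ ψ : AddChar G ℂ, ψ ≠ 0 → ‖∑ x ∈ A, ψ (F x)‖ ≤ η * #A) :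
    DominatesUpTo η (distOn A F) (uniformMass G) := by
  classical
  intro y
  have hA0 : (0 : ℝ) < #A := by exact_mod_cast hA.card_pos
  have hG : (0 : ℝ) < Fintype.card G := by exact_mod_cast Fintype.card_pos
  have inversion : ∑ ψ : AddChar G ℂ, ψ (-y) * ∑ x ∈ A, ψ (F x)
      = Fintype.card G * #{x ∈ A | F x = y} := by
    simp only [mul_sum, ← AddChar.map_add_eq_mul]
    rw [sum_comm]
    simp only [AddChar.sum_apply_eq_ite, neg_add_eq_zero, eq_comm (a := y), ← sum_filter, sum_const,
      nsmul_eq_mul]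
    exact mul_comm _ _
  rw [← add_sum_erase _ _ (mem_univ (0 : AddChar G ℂ))] at inversion
  simp only [AddChar.zero_apply, sum_const, nsmul_eq_mul, mul_one, one_mul] at inversion
  have hdeviation : ‖(Fintype.card G * #{x ∈ A | F x = y} - #A : ℂ)‖ ≤
      Fintype.card G * (η * #A) :=
    calc ‖(Fintype.card G * #{x ∈ A | F x = y} - #A : ℂ)‖
        = ‖∑ ψ ∈ univ.erase (0 : AddChar G ℂ), ψ (-y) * ∑ x ∈ A, ψ (F x)‖ := by
          rw [← inversion, add_sub_cancel_left]
      _ ≤ ∑ _ψ ∈ univ.erase (0 : AddChar G ℂ), η * #A := norm_sum_le_of_le _ fun ψ hψ => by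
          rw [norm_mul, AddChar.norm_apply, one_mul]
          exact h ψ (ne_of_mem_erase hψ)
      _ ≤ Fintype.card G * (η * #A) := by
          rw [sum_const, nsmul_eq_mul, ← AddChar.card_eq (α := G)]
          gcongr
          exact card_le_univ _
  have hlower : -(Fintype.card G * (η * #A)) ≤ Fintype.card G * #{x ∈ A | F x = y} - (#A : ℝ) := by
    refine (abs_le.mp ?_).1
    rw [← Real.norm_eq_abs, ← Complex.norm_real]
    push_cast
    exact hdeviation
  unfold distOn uniformMass
  rw [le_div_iff₀ hA0, sub_mul, one_div_mul_eq_div, sub_le_iff_le_add, div_le_iff₀ hG]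
  linarith

theorem norm_one_add_lt_two_of_norm_eq_one {z : ℂ} (hz : ‖z‖ = 1) (hz1 : z ≠ 1) :
    ‖1 + z‖ < 2 := by
  have hlt : ‖1 + z‖ < ‖(1 : ℂ)‖ + ‖z‖ := (norm_add_le _ _).lt_of_ne fun h =>
    hz1 ((sameRay_iff_of_norm_eq (by rw [hz, norm_one])).mp (sameRay_iff_norm_add.mpr h)).symm
  rw [hz, norm_one] at hlt
  linarith

theorem addChar_apply_ne_one {p : ℕ} [Fact p.Prime] {ψ : AddChar (ZMod p) ℂ} (hψ : ψ ≠ 0)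
    {a : ZMod p} (ha : a ≠ 0) : ψ a ≠ 1 := fun h => hψ <| DFunLike.ext _ _ fun x => by
  have hx : x = (x * a⁻¹).val • a := by simp [nsmul_eq_mul, ha]
  rw [hx, AddChar.map_nsmul_eq_pow, h, one_pow, AddChar.zero_apply]

theorem exists_norm_one_add_addChar_le (p : ℕ) [Fact p.Prime] :
    ∃ θ ∈ Set.Ioo (0 : ℝ) 1, ∀ ψ : AddChar (ZMod p) ℂ, ψ ≠ 0 →
      ∀ a ≠ 0, ‖1 + ψ a‖ ≤ 2 * θ := by
  have hbound (ψ : AddChar (ZMod p) ℂ) (a : ZMod p) :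
      ∀ᶠ θ in nhdsWithin (1 : ℝ) (Set.Iio 1), ψ ≠ 0 → a ≠ 0 → ‖1 + ψ a‖ ≤ 2 * θ := by
    by_cases h : ψ ≠ 0 ∧ a ≠ 0
    · have hlt := norm_one_add_lt_two_of_norm_eq_one (AddChar.norm_apply ψ a)
        (addChar_apply_ne_one h.1 h.2)
      filter_upwards [Ioo_mem_nhdsLT (show ‖1 + ψ a‖ / 2 < 1 by linarith)] with θ hθ _ _
      linarith [hθ.1]
    · exact .of_forall fun θ hψ ha => absurd ⟨hψ, ha⟩ h
  obtain ⟨θ, hθ, hall⟩ := ((Filter.eventually_of_mem (Ioo_mem_nhdsLT one_pos) fun _ => id).and <|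
    Filter.eventually_all.mpr fun ψ => Filter.eventually_all.mpr (hbound ψ)).exists
  exact ⟨θ, hθ, fun ψ hψ a ha => hall ψ a hψ ha⟩

/-- The restriction to the cube of the linear form with coefficients `c`. -/
def cubeForm {p n : ℕ} (c : Fin n → ZMod p) (x : Cube n) : ZMod p :=
  c ⬝ᵥ x.toZMod p

theorem sum_addChar_cubeForm {p n : ℕ} (ψ : AddChar (ZMod p) ℂ) (c : Fin n → ZMod p) :
    ∑ x, ψ (cubeForm c x) = ∏ i, (1 + ψ (c i)) := by
  have hprod (x : Cube n) : ψ (cubeForm c x) = ∏ i, ψ (c i * (x i : ℕ)) := by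
    simpa [cubeForm, dotProduct, Cube.toZMod, ← ofAdd_sum] using
      map_prod ψ.toMonoidHom (fun i => Multiplicative.ofAdd (c i * (x i : ℕ))) univ
  have hexpand := prod_univ_sum (fun _ : Fin n => (univ : Finset (Fin 2)))
    fun i b => ψ (c i * (b : ℕ))
  simp only [hprod]
  simpa [Fin.sum_univ_two] using hexpand.symm

theorem norm_sum_addChar_cubeForm_le {p n : ℕ} {ψ : AddChar (ZMod p) ℂ} {θ : ℝ}
    (hθ : ∀ a ≠ 0, ‖1 + ψ a‖ ≤ 2 * θ) (c : Fin n → ZMod p) :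
    ‖∑ x, ψ (cubeForm c x)‖ ≤ 2 ^ n * θ ^ hammingNorm c := by
  rw [sum_addChar_cubeForm, norm_prod]
  calc ∏ i, ‖1 + ψ (c i)‖ ≤ ∏ i, 2 * (if c i ≠ 0 then θ else 1) := by
        refine prod_le_prod (fun _ _ => norm_nonneg _) fun i _ => ?_
        split_ifs with h
        · exact hθ _ h
        · rw [not_not.mp h, AddChar.map_zero_eq_one]; norm_num
    _ = 2 ^ n * θ ^ hammingNorm c := by
        rw [prod_mul_distrib, prod_const, card_fin, prod_ite, prod_const, prod_const_one, mul_one,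
          hammingNorm]

/-- Halász's inequality. -/
theorem sq_sum_norm_inner_le {𝕜 V ι : Type*} [RCLike 𝕜] [NormedAddCommGroup V]
    [InnerProductSpace 𝕜 V] (s : Finset ι) (f : V) (v : ι → V) :
    (∑ c ∈ s, ‖inner 𝕜 f (v c)‖) ^ 2 ≤
      ‖f‖ ^ 2 * ∑ c ∈ s, ∑ d ∈ s, ‖inner 𝕜 (v c) (v d)‖ := by
  choose u hu hu_inner using fun c => RCLike.exists_norm_eq_mul_self (inner 𝕜 f (v c))
  set w : V := ∑ c ∈ s, u c • v c
  have hsum : ∑ c ∈ s, ‖inner 𝕜 f (v c)‖ ≤ ‖f‖ * ‖w‖ :=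
    calc ∑ c ∈ s, ‖inner 𝕜 f (v c)‖ = ‖((∑ c ∈ s, ‖inner 𝕜 f (v c)‖ : ℝ) : 𝕜)‖ := by
          rw [RCLike.norm_ofReal, abs_of_nonneg (sum_nonneg fun _ _ => norm_nonneg _)]
      _ = ‖inner 𝕜 f w‖ := by
          rw [inner_sum, RCLike.ofReal_sum]
          simp only [hu_inner, inner_smul_right]
      _ ≤ ‖f‖ * ‖w‖ := norm_inner_le_norm f w
  have hw : ‖w‖ ^ 2 ≤ ∑ c ∈ s, ∑ d ∈ s, ‖inner 𝕜 (v c) (v d)‖ := by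
    have hnorm : ‖w‖ ^ 2 = ‖inner 𝕜 w w‖ := by simp [inner_self_eq_norm_sq_to_K]
    rw [hnorm, sum_inner]
    refine norm_sum_le_of_le _ fun c _ => ?_
    rw [inner_sum]
    refine norm_sum_le_of_le _ fun d _ => ?_
    rw [inner_smul_left, inner_smul_right, norm_mul, norm_mul, RCLike.norm_conj, hu, hu, one_mul,
      one_mul]
  calc (∑ c ∈ s, ‖inner 𝕜 f (v c)‖) ^ 2 ≤ (‖f‖ * ‖w‖) ^ 2 := by gcongr
    _ = ‖f‖ ^ 2 * ‖w‖ ^ 2 := mul_pow _ _ _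
    _ ≤ ‖f‖ ^ 2 * ∑ c ∈ s, ∑ d ∈ s, ‖inner 𝕜 (v c) (v d)‖ := by gcongr

open ComplexConjugate in
theorem sq_sum_norm_sum_le {α ι : Type*} [Fintype α] (A : Finset α) (s : Finset ι)
    (e : ι → α → ℂ) :
    (∑ c ∈ s, ‖∑ x ∈ A, e c x‖) ^ 2 ≤ #A * ∑ c ∈ s, ∑ d ∈ s, ‖∑ x, e d x * conj (e c x)‖ := by
  classical
  have h := sq_sum_norm_inner_le (𝕜 := ℂ) s (WithLp.toLp 2 fun x => if x ∈ A then (1 : ℂ) else 0)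
    fun c => WithLp.toLp 2 (e c)
  simpa [PiLp.inner_apply, EuclideanSpace.norm_sq_eq, apply_ite] using h

theorem hammingNorm_update_zero_lt {ι α : Type*} [Fintype ι] [DecidableEq ι] [DecidableEq α]
    [Zero α] {c : ι → α} {i : ι} (hi : c i ≠ 0) :
    hammingNorm (Function.update c i 0) < hammingNorm c := by
  refine card_lt_card ⟨fun j => ?_, fun h => ?_⟩
  · by_cases hj : j = i <;> simp [hj]
  · simpa using h (show i ∈ _ by simpa using hi)

theorem card_filter_hammingNorm_le {ι α : Type*} [Fintype ι] [DecidableEq ι] [Fintype α]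
    [DecidableEq α] [Zero α] (L : ℕ) :
    #{c : ι → α | hammingNorm c ≤ L} ≤ (Fintype.card ι * Fintype.card α + 1) ^ L := by
  induction L with
  | zero => simp [filter_eq']
  | succ L ih =>
    set ball : Finset (ι → α) := {c | hammingNorm c ≤ L} with hball
    let extend (q : (ι → α) × Option (ι × α)) : ι → α :=
      q.2.elim q.1 fun ia => Function.update q.1 ia.1 ia.2
    have hcover : ({c | hammingNorm c ≤ L + 1} : Finset (ι → α)) ⊆
        image extend (ball ×ˢ (univ : Finset (Option (ι × α)))) := by
      intro c hc
      rw [mem_filter_univ] at hc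
      simp only [hball, mem_image, mem_product, mem_filter_univ, mem_univ, and_true]
      rcases eq_or_ne c 0 with rfl | hc0
      · exact ⟨(0, none), by simp, rfl⟩
      · obtain ⟨i, hi⟩ := Function.ne_iff.mp hc0
        exact ⟨(Function.update c i 0, some (i, c i)),
          Nat.le_of_lt_succ ((hammingNorm_update_zero_lt hi).trans_le hc), by simp [extend]⟩
    calc #{c : ι → α | hammingNorm c ≤ L + 1}
        ≤ #(ball ×ˢ (univ : Finset (Option (ι × α)))) :=
          (card_le_card hcover).trans card_image_le
      _ = #ball * (Fintype.card ι * Fintype.card α + 1) := by simp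
      _ ≤ (Fintype.card ι * Fintype.card α + 1) ^ (L + 1) := by rw [pow_succ]; gcongr

theorem sum_pow_hammingDist_le {ι α : Type*} [Fintype ι] [Fintype α] [DecidableEq α] [AddGroup α]
    {θ : ℝ} (hθ : θ ∈ Set.Icc 0 1) (H : Finset (ι → α)) (d : ι → α) (L : ℕ) :
    ∑ c ∈ H, θ ^ hammingDist d c ≤
      ((Fintype.card ι * Fintype.card α + 1 : ℕ) : ℝ) ^ L + #H * θ ^ L := by
  classical
  rw [← sum_filter_add_sum_filter_not H (fun c => hammingDist d c ≤ L)]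
  refine add_le_add ?_ ?_
  · calc ∑ c ∈ H with hammingDist d c ≤ L, θ ^ hammingDist d c
        ≤ #{c ∈ H | hammingDist d c ≤ L} • (1 : ℝ) :=
          sum_le_card_nsmul _ _ _ fun c _ => pow_le_one₀ hθ.1 hθ.2
      _ ≤ #{c : ι → α | hammingNorm c ≤ L} := by
          rw [nsmul_one]
          exact_mod_cast card_le_card_of_injOn (fun c => -d + c)
            (fun c hc => by simpa [hammingDist_eq_hammingNorm] using (mem_filter.mp hc).2)
            fun _ _ _ _ h => add_right_injective (-d) h
      _ ≤ _ := by exact_mod_cast card_filter_hammingNorm_le L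
  · calc ∑ c ∈ H with ¬ hammingDist d c ≤ L, θ ^ hammingDist d c
        ≤ #{c ∈ H | ¬ hammingDist d c ≤ L} • θ ^ L := sum_le_card_nsmul _ _ _ fun c hc =>
          pow_le_pow_of_le_one hθ.1 hθ.2 (not_le.mp (mem_filter.mp hc).2).le
      _ ≤ #H * θ ^ L := by
          rw [nsmul_eq_mul]
          have := pow_nonneg hθ.1 L
          gcongr
          exact filter_subset _ _

open ComplexConjugate in
theorem norm_sum_addChar_cubeForm_mul_conj_le {p n : ℕ} [NeZero p] {ψ : AddChar (ZMod p) ℂ} {θ : ℝ}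
    (hθ : ∀ a ≠ 0, ‖1 + ψ a‖ ≤ 2 * θ) (c d : Fin n → ZMod p) :
    ‖∑ x, ψ (cubeForm d x) * conj (ψ (cubeForm c x))‖ ≤ 2 ^ n * θ ^ hammingDist c d := by
  have hmul (x : Cube n) :
      ψ (cubeForm d x) * conj (ψ (cubeForm c x)) = ψ (cubeForm (-c + d) x) := by
    rw [← AddChar.map_neg_eq_conj, ← AddChar.map_add_eq_mul, cubeForm, cubeForm, cubeForm,
      add_dotProduct, neg_dotProduct, add_comm]
  simp only [hmul, hammingDist_eq_hammingNorm]
  exact norm_sum_addChar_cubeForm_le hθ (-c + d)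

/-- The linear forms, given by their coefficients, at which the Fourier coefficient of the indicator
function of `A` along the additive character `ψ` is at least `η` times the largest possible. -/
noncomputable def largeSpectrum {p n : ℕ} [NeZero p] (ψ : AddChar (ZMod p) ℂ) (A : Finset (Cube n))
    (η : ℝ) : Finset (Fin n → ZMod p) :=
  {c | η * #A ≤ ‖∑ x ∈ A, ψ (cubeForm c x)‖}

theorem card_largeSpectrum_le {p n : ℕ} [NeZero p] {ψ : AddChar (ZMod p) ℂ} {θ : ℝ}
    (hθ01 : θ ∈ Set.Icc 0 1) (hθ : ∀ a ≠ 0, ‖1 + ψ a‖ ≤ 2 * θ) {A : Finset (Cube n)} {δ η : ℝ}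
    (hδ : 0 < δ) (hA : δ ≤ A.dens) (hη : 0 < η) {L : ℕ} (hL : θ ^ L ≤ δ * η ^ 2 / 2) :
    (#(largeSpectrum ψ A η) : ℝ) ≤ 2 / (δ * η ^ 2) * ((n * p + 1 : ℕ) : ℝ) ^ L := by
  set H := largeSpectrum ψ A η with hH
  set B : ℝ := ((n * p + 1 : ℕ) : ℝ) ^ L
  rcases H.eq_empty_or_nonempty with hempty | hne
  · rw [hempty, card_empty, Nat.cast_zero]; positivity
  have hA0 : (0 : ℝ) < #A := by
    exact_mod_cast (dens_pos.mp (by exact_mod_cast hδ.trans_le hA) : A.Nonempty).card_pos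
  have hH0 : (0 : ℝ) < #H := by exact_mod_cast hne.card_pos
  have hcardA : δ * 2 ^ n ≤ #A := by simpa using mul_card_le_card_of_le_dens hA
  have hlarge : #H * (η * #A) ≤ ∑ c ∈ H, ‖∑ x ∈ A, ψ (cubeForm c x)‖ := by
    rw [← nsmul_eq_mul]
    exact card_nsmul_le_sum H _ _ fun c hc => (mem_filter.mp hc).2
  have hsq : (#H * (η * #A)) ^ 2 ≤ #A * (#H * (2 ^ n * (B + #H * θ ^ L))) :=
    calc (#H * (η * #A)) ^ 2 ≤ (∑ c ∈ H, ‖∑ x ∈ A, ψ (cubeForm c x)‖) ^ 2 := by gcongr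
      _ ≤ #A * ∑ c ∈ H, ∑ d ∈ H, 2 ^ n * θ ^ hammingDist c d := by
        refine (sq_sum_norm_sum_le A H _).trans ?_
        gcongr with c _ d _
        exact norm_sum_addChar_cubeForm_mul_conj_le hθ c d
      _ ≤ #A * ∑ c ∈ H, 2 ^ n * (B + #H * θ ^ L) := by
        simp only [← mul_sum]
        gcongr with c _
        simpa [B] using sum_pow_hammingDist_le hθ01 H c L
      _ = #A * (#H * (2 ^ n * (B + #H * θ ^ L))) := by rw [sum_const, nsmul_eq_mul]
  have hcancel : #H * η ^ 2 * #A ≤ 2 ^ n * (B + #H * θ ^ L) :=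
    le_of_mul_le_mul_left (by linarith) (mul_pos hH0 hA0)
  have hscaled : #H * η ^ 2 * δ ≤ B + #H * θ ^ L := by
    refine le_of_mul_le_mul_left ?_ (by positivity : (0 : ℝ) < 2 ^ n)
    linarith [mul_le_mul_of_nonneg_left hcardA (by positivity : 0 ≤ #H * η ^ 2)]
  rw [div_mul_eq_mul_div, le_div_iff₀ (by positivity)]
  linarith [mul_le_mul_of_nonneg_left hL hH0.le]

open scoped Classical in
/-- The linear forms, given by their coefficients, that take some value on `A` with a probability
smaller than `1 / p - η`. -/
noncomputable def biasedForms {p n : ℕ} [NeZero p] (A : Finset (Cube n)) (η : ℝ) :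
    Finset (Fin n → ZMod p) :=
  {c | ¬ DominatesUpTo η (distOn A (cubeForm c)) (uniformMass (ZMod p))}

theorem exists_mem_largeSpectrum_of_mem_biasedForms {p n : ℕ} [NeZero p] {A : Finset (Cube n)}
    (hA : A.Nonempty) {η : ℝ} (hη : 0 ≤ η) {c : Fin n → ZMod p} (hc : c ∈ biasedForms A η) :
    ∃ ψ : AddChar (ZMod p) ℂ, ψ ≠ 0 ∧ c ∈ largeSpectrum ψ A η := by
  by_contra! h
  classical
  refine (mem_filter.mp hc).2 (dominatesUpTo_uniformMass_of_norm_sum_le hA _ hη fun ψ hψ => ?_)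
  have hsmall := h ψ hψ
  rw [largeSpectrum, mem_filter_univ, not_le] at hsmall
  exact hsmall.le

theorem card_biasedForms_le {p n : ℕ} [NeZero p] {θ : ℝ} (hθ01 : θ ∈ Set.Icc 0 1)
    (hθ : ∀ ψ : AddChar (ZMod p) ℂ, ψ ≠ 0 → ∀ a ≠ 0, ‖1 + ψ a‖ ≤ 2 * θ) {A : Finset (Cube n)}
    {δ η : ℝ} (hδ : 0 < δ) (hA : δ ≤ A.dens) (hη : 0 < η) {L : ℕ} (hL : θ ^ L ≤ δ * η ^ 2 / 2) :
    (#(biasedForms (p := p) A η) : ℝ)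
      ≤ p * (2 / (δ * η ^ 2) * ((n * p + 1 : ℕ) : ℝ) ^ L) := by
  classical
  have hne : A.Nonempty := dens_pos.mp (by exact_mod_cast hδ.trans_le hA)
  have hcover : biasedForms A η ⊆
      ({ψ | ψ ≠ 0} : Finset (AddChar (ZMod p) ℂ)).biUnion fun ψ => largeSpectrum ψ A η := by
    intro c hc
    simpa using exists_mem_largeSpectrum_of_mem_biasedForms hne hη.le hc
  calc (#(biasedForms (p := p) A η) : ℝ)
      ≤ ∑ ψ : AddChar (ZMod p) ℂ with ψ ≠ 0, (#(largeSpectrum ψ A η) : ℝ) := by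
        exact_mod_cast (card_le_card hcover).trans card_biUnion_le
    _ ≤ #{ψ : AddChar (ZMod p) ℂ | ψ ≠ 0} • (2 / (δ * η ^ 2) * ((n * p + 1 : ℕ) : ℝ) ^ L) :=
        sum_le_card_nsmul _ _ _ fun ψ hψ =>
          card_largeSpectrum_le hθ01 (hθ ψ (mem_filter.mp hψ).2) hδ hA hη hL
    _ ≤ p * (2 / (δ * η ^ 2) * ((n * p + 1 : ℕ) : ℝ) ^ L) := by
        have hcard : Fintype.card (AddChar (ZMod p) ℂ) = p := by rw [AddChar.card_eq, ZMod.card]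
        rw [nsmul_eq_mul]
        gcongr
        exact (card_le_univ _).trans hcard.le

end Fourier

section SampleSize

theorem exists_pow_two_mem_Icc {n : ℕ} (hn : 2 ≤ n) : ∃ l, 0 < l ∧ 2 ^ l ∈ Set.Icc n (n ^ 2) := by
  refine ⟨Nat.clog 2 n, Nat.clog_pos one_lt_two hn, Nat.le_pow_clog one_lt_two n, ?_⟩
  have hlt := Nat.pow_pred_clog_lt_self one_lt_two hn
  calc 2 ^ Nat.clog 2 n = 2 ^ (Nat.clog 2 n).pred * 2 := by
        rw [← pow_succ, Nat.pred_eq_sub_one, Nat.sub_add_cancel (Nat.clog_pos one_lt_two hn)]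
    _ ≤ n * n := by gcongr
    _ = n ^ 2 := (sq n).symm

/-- The sample size `k` is proportional to `l = ⌈log₂ n⌉`, so that both bounds reduce to comparisons
of `l`-th powers. -/
theorem exists_sample_size {ρ δ : ℝ} (hρ : ρ ∈ Set.Ico 0 1) (hδ : 0 < δ) (K : ℝ) (L : ℕ) :
    ∃ C : ℕ, 0 < C ∧ ∀ n : ℕ, 2 ≤ n → ∃ k : ℕ, 0 < k ∧
      K * (n : ℝ) ^ L * ρ ^ k ≤ 1 ∧ 1 / (n : ℝ) ^ C ≤ δ ^ k / 2 := by
  have hK : 0 < max K 1 * 2 ^ L := by positivity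
  obtain ⟨J, hJ⟩ := exists_pow_lt_of_lt_one (inv_pos.mpr hK) hρ.2
  have hJρ : max K 1 * 2 ^ L * ρ ^ (J + 1) ≤ 1 := by
    rw [mul_comm, ← le_div_iff₀ hK, one_div]
    exact (pow_le_pow_of_le_one hρ.1 hρ.2.le J.le_succ).trans hJ.le
  obtain ⟨C, hC⟩ := exists_pow_lt_of_lt_one (by positivity : 0 < δ ^ (J + 1) / 2) one_half_lt_one
  have hCδ : (1 / 2 : ℝ) ^ (C + 1) ≤ δ ^ (J + 1) / 2 :=
    (pow_le_pow_of_le_one (by norm_num) (by norm_num) C.le_succ).trans hC.le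
  refine ⟨2 * (C + 1), by positivity, fun n hn => ?_⟩
  obtain ⟨l, hl, hnl, hln⟩ := exists_pow_two_mem_Icc hn
  have hnl' : (n : ℝ) ≤ 2 ^ l := by exact_mod_cast hnl
  have hln' : (2 : ℝ) ^ l ≤ (n : ℝ) ^ 2 := by exact_mod_cast hln
  have hρ0 := hρ.1
  refine ⟨(J + 1) * l, by positivity, ?_, ?_⟩
  · calc K * (n : ℝ) ^ L * ρ ^ ((J + 1) * l)
        ≤ max K 1 ^ l * (2 ^ l) ^ L * ρ ^ ((J + 1) * l) := by
          gcongr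
          exact (le_max_left K 1).trans (le_self_pow₀ (le_max_right K 1) hl.ne')
      _ = (max K 1 * 2 ^ L * ρ ^ (J + 1)) ^ l := by
          rw [mul_pow, mul_pow, ← pow_mul, ← pow_mul, ← pow_mul, mul_comm l L]
      _ ≤ 1 := pow_le_one₀ (by positivity) hJρ
  · calc 1 / (n : ℝ) ^ (2 * (C + 1)) ≤ 1 / (2 ^ l) ^ (C + 1) := by
          rw [pow_mul]; gcongr
      _ = ((1 / 2 : ℝ) ^ (C + 1)) ^ l := by
          rw [← pow_mul, ← pow_mul, one_div_pow, mul_comm]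
      _ ≤ (δ ^ (J + 1) / 2) ^ l := by gcongr
      _ = δ ^ ((J + 1) * l) / 2 ^ l := by rw [div_pow, pow_mul]
      _ ≤ δ ^ ((J + 1) * l) / 2 := by
          gcongr
          exact le_self_pow₀ one_le_two hl.ne'

end SampleSize

section Structure

theorem exists_eq_cubeForm {p n : ℕ} (φ : ModForm p n) :
    ∃ c, (fun x : Cube n => φ (x.toZMod p)) = cubeForm c := by
  refine ⟨(dotProductEquiv (ZMod p) (Fin n)).symm φ, funext fun x => ?_⟩
  exact (LinearMap.congr_fun ((dotProductEquiv (ZMod p) (Fin n)).apply_symm_apply φ) _).symm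

theorem exists_sample_size_biasedForms (p : ℕ) [Fact p.Prime] {δ η : ℝ} (hδ : 0 < δ)
    (hη : 0 < η) :
    ∃ C : ℕ, 0 < C ∧ ∀ n : ℕ, 0 < n → ∃ k : ℕ, 0 < k ∧
      1 / ((n : ℝ) + 1) ^ C ≤ δ ^ k / 2 ∧ ∀ A : Finset (Cube n), δ ≤ A.dens →
        #(biasedForms (p := p) A η) * p * Real.exp (-(2 * k * η ^ 2)) ≤ 1 / 2 := by
  obtain ⟨θ, hθ01, hθ⟩ := exists_norm_one_add_addChar_le p
  obtain ⟨L, hL⟩ := exists_pow_lt_of_lt_one (by positivity : 0 < δ * η ^ 2 / 2) hθ01.2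
  have hρ : Real.exp (-(2 * η ^ 2)) ∈ Set.Ico 0 1 :=
    ⟨(Real.exp_pos _).le, Real.exp_lt_one_iff.mpr (neg_neg_of_pos (by positivity))⟩
  obtain ⟨C, hC, hsize⟩ := exists_sample_size hρ hδ (2 * (p * (2 / (δ * η ^ 2) * p ^ L) * p)) L
  refine ⟨C, hC, fun n hn => ?_⟩
  obtain ⟨k, hk, hfew, hmany⟩ := hsize (n + 1) (by omega)
  push_cast at hfew hmany
  refine ⟨k, hk, hmany, fun A hA => ?_⟩
  have hp : 1 ≤ p := NeZero.one_le
  have hbase : ((n * p + 1 : ℕ) : ℝ) ≤ p * (n + 1) := by exact_mod_cast (by nlinarith)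
  calc #(biasedForms (p := p) A η) * p * Real.exp (-(2 * k * η ^ 2))
      ≤ p * (2 / (δ * η ^ 2) * (p * (n + 1)) ^ L) * p * Real.exp (-(2 * η ^ 2)) ^ k := by
        rw [← Real.exp_nat_mul, show (k : ℝ) * -(2 * η ^ 2) = -(2 * k * η ^ 2) by ring]
        gcongr
        refine (card_biasedForms_le (Set.Ioo_subset_Icc_self hθ01) hθ hδ hA hη hL.le).trans ?_
        gcongr
    _ = 2 * (p * (2 / (δ * η ^ 2) * p ^ L) * p) * (n + 1) ^ L *
          Real.exp (-(2 * η ^ 2)) ^ k / 2 := by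
        rw [mul_pow]; ring
    _ ≤ 1 / 2 := by gcongr

theorem exists_common_law (p : ℕ) [Fact p.Prime] {δ η : ℝ} (hδ : 0 < δ) (hη : 0 < η) :
    ∃ C : ℕ, 0 < C ∧ ∀ (n : ℕ) {ι : Type*} [Fintype ι] (A : ι → Finset (Cube n)),
      (∀ i, δ ≤ (A i).dens) →
      ∃ (R : Finset ι) (E : (Fin n → ZMod p) → ZMod p → ℝ),
        Fintype.card ι / ((n : ℝ) + 1) ^ C ≤ #R ∧ (∀ c, E c ∈ stdSimplex ℝ (ZMod p)) ∧
        ∀ i ∈ R, ∀ c, DominatesUpTo η (distOn (A i) (cubeForm c)) (E c) ∨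
          DominatesUpTo η (distOn (A i) (cubeForm c)) (uniformMass (ZMod p)) := by
  classical
  obtain ⟨C, hC, hsize⟩ := exists_sample_size_biasedForms p hδ hη
  refine ⟨C, hC, fun n ι _ A hA => ?_⟩
  rcases n.eq_zero_or_pos with rfl | hn
  · have hA_univ (i : ι) : A i = univ :=
      (dens_pos.mp (by exact_mod_cast hδ.trans_le (hA i))).eq_univ
    exact ⟨univ, fun c => distOn univ (cubeForm c), by simp,
      fun c => distOn_mem_stdSimplex univ_nonempty _,
      fun i _ c => .inl fun d => by rw [hA_univ i]; exact sub_le_self _ hη.le⟩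
  obtain ⟨k, hk, hmany, hfew⟩ := hsize n hn
  have : NeZero k := ⟨hk.ne'⟩
  obtain ⟨x, R, hR, hx⟩ := exists_common_sample (κ := Fin k) A hδ hA
    (fun i => biasedForms (p := p) (A i) η) cubeForm hη.le
    fun i => by simpa only [Fintype.card_fin, ZMod.card] using hfew (A i) (hA i)
  refine ⟨R, fun c => distOn univ (cubeForm c ∘ x), le_trans ?_ hR,
    fun c => distOn_mem_stdSimplex univ_nonempty _, fun i hi c => ?_⟩
  · rw [Fintype.card_fin, ← mul_one_div]
    gcongr
  · refine (em (c ∈ biasedForms (A i) η)).imp (hx i hi c) fun hc => ?_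
    simpa [biasedForms] using hc

end Structure

theorem mainTheorem1_general (p : ℕ) [Fact p.Prime] {m : ℕ} (hm : 0 < m) {δ ν : ℝ} (hδ : 0 < δ)
    (hν : 0 < ν) :
    ∃ C : ℝ, 0 < C ∧ ∀ (n : ℕ) {ι : Type*} [Fintype ι] (A : ι → Finset (Cube n)),
      (∀ i, δ ≤ (A i).dens) →
      ∃ R : Finset ι, Fintype.card ι / ((n : ℝ) + 1) ^ C ≤ #R ∧
        ∀ i : Fin m → ι, (∀ t, i t ∈ R) → ∀ φ : ModForm p n,
          -ν ≤ formCorrelation (fun t => A (i t)) φ := by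
  have hp : (0 : ℝ) < p := by exact_mod_cast NeZero.pos p
  obtain ⟨C, hC, hlaw⟩ := exists_common_law p hδ (η := ν / (p * m)) (by positivity)
  refine ⟨C, by exact_mod_cast hC, fun n ι _ A hA => ?_⟩
  obtain ⟨R, E, hR, hE, hRE⟩ := hlaw n A hA
  refine ⟨R, by rwa [Real.rpow_natCast], fun i hi φ => ?_⟩
  obtain ⟨c, hc⟩ := exists_eq_cubeForm φ
  have hne (t : Fin m) : (A (i t)).Nonempty :=
    dens_pos.mp (by exact_mod_cast hδ.trans_le (hA (i t)))
  have hcor := neg_le_correlation hm (fun t => distOn_mem_stdSimplex (hne t) (cubeForm c)) (hE c)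
    (η := ν / (p * m)) (by positivity) fun t => hRE (i t) (hi t) c
  have hν_eq : (p : ℝ) * (m * (ν / (p * m))) = ν := by field_simp
  rwa [ZMod.card, hν_eq, ← hc] at hcor

theorem card_pow_le_ncard_of_forall {ι : Type*} {m : ℕ} {R : Finset ι}
    {P : (Fin m → ι) → Prop} (hP : ∀ i, (∀ t, i t ∈ R) → P i) :
    #R ^ m ≤ {i : Fin m → ι | (∀ t, i t ∈ R) ∧ P i}.ncard := by
  have hset : {i : Fin m → ι | (∀ t, i t ∈ R) ∧ P i} =
      ↑(Fintype.piFinset fun _ : Fin m => R) := by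
    ext i; simpa using hP i
  rw [hset, Set.ncard_coe_finset, Fintype.card_piFinset_const]

theorem mainTheorem1 (p : ℕ) [Fact p.Prime] (m : ℕ) (hm : 2 ≤ m) (δ ν ε : ℝ)
    (hδ : 0 < δ) (hν : 0 < ν) (hε : 0 < ε) :
    ∃ C : ℝ, 0 < C ∧
      ∀ (n s : ℕ), 0 < s →
        ∀ A : Fin s → Finset (Cube n),
          (∀ i, (A i).Nonempty) →
          (∀ i, δ ≤ ((A i).dens : ℝ)) →
          ∃ R : Finset (Fin s),
            (s : ℝ) / ((n : ℝ) + 1) ^ C ≤ (R.card : ℝ) ∧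
            (1 - ε) * (R.card : ℝ) ^ m ≤
              (({i : Fin m → Fin s | (∀ t, i t ∈ R) ∧
                ∀ φ : ModForm p n, -ν ≤ formCorrelation (fun t => A (i t)) φ}.ncard : ℕ) : ℝ) := by
  obtain ⟨C, hC, hgeneral⟩ := mainTheorem1_general p (by omega : 0 < m) hδ hν
  refine ⟨C, hC, fun n s _ A _ hA => ?_⟩
  obtain ⟨R, hR, hcor⟩ := hgeneral n A hA
  refine ⟨R, by simpa using hR, ?_⟩
  calc (1 - ε) * (R.card : ℝ) ^ m ≤ (R.card : ℝ) ^ m :=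
        mul_le_of_le_one_left (by positivity) (by linarith)
    _ ≤ _ := by exact_mod_cast card_pow_le_ncard_of_forall hcor
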